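/- **Theorem 3.7.** Let $\mathcal L$ be a countable first-order language and let $M$ be a countably infinite $\mathcal L$-structure that is $\omega$-categorical (any two countably infinite models of its complete theory are isomorphic). Suppose that $M$ is a *Ramsey structure*, that is: every finite subset of $M$ lies in a finite substructure; every isomorphism between finite substructures of $M$ extends to an automorphism of $M$; every finite structure embeddable in $M$ has trivial automorphism group; and the age of $M$ (the class $\mathcal C$ of finite $\mathcal L$-structures embeddable in $M$) is a Ramsey class, meaning that $\mathcal C$ is closed under isomorphisms and substructures and that for all $A \subseteq B \in \mathcal C$ and all $k\in\mathbb N$ there is $C \in \mathcal C$ with $B \subseteq C$ such that for every colouring with $k$ colours of the copies of $A$ in $C$ (the substructures of $C$ isomorphic to $A$) there is a copy $B'$ of $B$ in $C$ such that all copies of $A$ contained in $B'$ have the same colour. Let $G = \mathrm{Aut}(M)$. Let $M^{eq}$ be the set of imaginary elements of $M$, the disjoint union, over all $n$, all $\emptyset$-definable $D \subseteq M^n$ and all $\emptyset$-definable equivalence relations $E$ on $D$, of the quotients $D/E$, with the natural action of $G$. Let $W \subseteq M^{eq}$ be a finite union of $G$-orbits $W_1,\dots,W_r$ (pairwise distinct),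 let $F$ be a field, and let $FW$ be the $F$-vector space with basis $W$, regarded as an $FG$-module through the action of $G$ on $W$. Let $\mathrm{Aug}^0(FW)$ be the kernel of the generalised augmentation map $$\Omega : FW \to F^r,\qquad \sum_{w\in W}\alpha_w w \mapsto \Big(\sum_{w\in W_1}\alpha_w,\ \dots,\ \sum_{w\in W_r}\alpha_w\Big).$$ Then every finitely generated $FG$-submodule of $\mathrm{Aug}^0(FW)$ is cyclic, that is, generated as an $FG$-module by a single element. -/

import Mathlib

universe u v w x

open scoped FirstOrder

namespace RamseyPerm

/-! ### ω-categorical structures -/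

/-- A structure (in a countable language) is ω-categorical if it is countably infinite and any two
countably infinite models of its complete theory are isomorphic. -/
structure IsOmegaCategorical (L : FirstOrder.Language.{u, v}) (M : Type w) [L.Structure M] : Prop where
  countable : Countable M
  infinite : Infinite M
  categorical : Cardinal.Categorical (Cardinal.aleph0.{w}) (L.completeTheory M)

/-! ### Ramsey structures -/

/-- The copies of `A` inside `C`: the substructures of `C` that are isomorphic to `A`. -/
def copies (L : FirstOrder.Language.{u, v}) (A C : Type w) [L.Structure A] [L.Structure C] :
    Set (L.Substructure C) :=
  {A' | Nonempty (A ≃[L] A')}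

/-- A Ramsey class of finite structures: it is closed under isomorphism and under substructures,
and for all `A ⊆ B ∈ K` and all `k` there is `C ∈ K` containing a copy of `B` such that for every
`k`-colouring of the copies of `A` in `C` there is a copy `B'` of `B` in `C` such that all copies
of `A` in `B'` have the same colour. -/
structure IsRamseyClass (L : FirstOrder.Language.{u, v})
    (K : Set (CategoryTheory.Bundled.{w} L.Structure)) : Prop where
  finite : ∀ A ∈ K, Finite A
  iso_closed : ∀ A B : CategoryTheory.Bundled.{w} L.Structure,
    A ∈ K → Nonempty (A ≃[L] B) → B ∈ K
  substructure_closed : ∀ B ∈ K, ∀ A : L.Substructure B,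
    (⟨A, inferInstance⟩ : CategoryTheory.Bundled.{w} L.Structure) ∈ K
  ramsey : ∀ B ∈ K, ∀ A : L.Substructure B, ∀ k : ℕ,
    ∃ C ∈ K, Nonempty (B ↪[L] C) ∧
      ∀ f : copies L A C → Fin k,
        ∃ B' ∈ copies L B C, ∀ A₁ A₂ : copies L A C,
          A₁.1 ≤ B' → A₂.1 ≤ B' → f A₁ = f A₂

/-- A Ramsey structure: a countable Fraïssé structure (every isomorphism between finite
substructures extends to an automorphism, and every finite subset lies in a finite substructure)
whose age is a Ramsey class of rigid finite structures. In a locally finite structure the finitely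
generated substructures are exactly the finite ones, so `IsUltrahomogeneous` and `age`, which speak
of finitely generated structures, are the notions for finite ones. -/
structure IsRamseyStructure (L : FirstOrder.Language.{u, v}) (M : Type w) [L.Structure M] : Prop where
  countable : Countable M
  locallyFinite : ∀ s : Set M, s.Finite → (FirstOrder.Language.Substructure.closure L s : Set M).Finite
  ultrahomogeneous : L.IsUltrahomogeneous M
  isRamseyClass : IsRamseyClass L (L.age M)
  rigid : ∀ A ∈ L.age M, ∀ g : A ≃[L] A, g = FirstOrder.Language.Equiv.refl L A

/-! ### The automorphism group and its action on the imaginary elements -/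

section Aut

variable (L : FirstOrder.Language.{u, v}) (M : Type w) [L.Structure M]

/-- The automorphism group of `M`. -/
abbrev Aut : Type w := M ≃[L] M

instance : Group (Aut L M) where
  mul g h := FirstOrder.Language.Equiv.comp g h
  one := FirstOrder.Language.Equiv.refl L M
  inv g := FirstOrder.Language.Equiv.symm g
  mul_assoc _ _ _ := rfl
  one_mul g := FirstOrder.Language.Equiv.refl_comp g
  mul_one g := FirstOrder.Language.Equiv.comp_refl g
  inv_mul_cancel g := FirstOrder.Language.Equiv.symm_comp_self g

theorem aut_mul_apply (g h : Aut L M) (a : M) : (g * h) a = g (h a) := rfl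

theorem aut_one_apply (a : M) : (1 : Aut L M) a = a := rfl

variable {L M} in
/-- Sets definable without parameters are invariant under automorphisms. -/
theorem mem_iff_of_definable {α : Type*} {D : Set (α → M)} (hD : (∅ : Set M).Definable L D)
    (g : Aut L M) (a : α → M) : (fun i => g (a i)) ∈ D ↔ a ∈ D := by
  obtain ⟨φ, rfl⟩ := Set.empty_definable_iff.mp hD
  exact FirstOrder.Language.StrongHomClass.realize_formula g φ

/-- A sort `D / E` of `M^eq`: a ∅-definable set `D` of `n`-tuples together with a ∅-definable
equivalence relation `E` on `D`. -/
structure ImagSort where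
  arity : ℕ
  dom : Set (Fin arity → M)
  rel : Setoid dom
  definable_dom : (∅ : Set M).Definable L dom
  definable_rel : (∅ : Set M).Definable L
    {c : Fin arity ⊕ Fin arity → M |
      ∃ (h₁ : (fun i => c (Sum.inl i)) ∈ dom) (h₂ : (fun i => c (Sum.inr i)) ∈ dom),
        rel ⟨_, h₁⟩ ⟨_, h₂⟩}

/-- The set `M^eq` of imaginary elements of `M`, the disjoint union of all sorts `D / E`.
The home sort `M` is the sort with `D = M¹` and `E` equality. -/
def Meq : Type w := Σ s : ImagSort L M, Quotient s.rel

variable {L M}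

/-- The coordinatewise action of an automorphism on the domain of a sort. -/
def ImagSort.domMap (s : ImagSort L M) (g : Aut L M) (a : s.dom) : s.dom :=
  ⟨fun i => g (a.1 i), (mem_iff_of_definable s.definable_dom g a.1).mpr a.2⟩

theorem ImagSort.rel_domMap (s : ImagSort L M) (g : Aut L M) {a b : s.dom} (h : s.rel a b) :
    s.rel (s.domMap g a) (s.domMap g b) := by
  have key := (mem_iff_of_definable s.definable_rel g (Sum.elim a.1 b.1)).mpr ⟨a.2, b.2, h⟩
  obtain ⟨_, _, h'⟩ := key
  exact h'

/-- The action of an automorphism on the imaginary elements of a sort: `g [a] = [g a]`. -/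
def ImagSort.map (s : ImagSort L M) (g : Aut L M) : Quotient s.rel → Quotient s.rel :=
  Quotient.map (s.domMap g) fun _ _ h => s.rel_domMap g h

instance : MulAction (Aut L M) (Meq L M) where
  smul g e := ⟨e.1, e.1.map g e.2⟩
  one_smul := by
    rintro ⟨s, q⟩
    induction q using Quotient.inductionOn
    rfl
  mul_smul := by
    rintro g h ⟨s, q⟩
    induction q using Quotient.inductionOn
    rfl

end Aut

/-! ### Permutation modules and the generalised augmentation map -/

section Modules

variable (F : Type x) [Field F] {G : Type u} [Group G] (W : Type v) [MulAction G W]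

variable (G) in
/-- The permutation module `FW`, the `F`-vector space with basis `W`, as a module for the group
algebra `FG`. -/
abbrev PermModule : Type (max x v) := (Representation.ofMulAction F G W).asModule

variable (G) in
/-- The `F`-linear map sending `∑ α_w w` to the family, indexed by the `G`-orbits `O` on `W`, of
the sums `∑_{w ∈ O} α_w`. -/
noncomputable def augLinear : MonoidAlgebra F W →ₗ[F] (MulAction.orbitRel.Quotient G W → F) :=
  Finsupp.lcoeFun ∘ₗ
    Finsupp.lmapDomain F F (fun w : W => (Quotient.mk'' w : MulAction.orbitRel.Quotient G W)) ∘ₗ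
      (MonoidAlgebra.coeffLinearEquiv F).toLinearMap

open Classical in
theorem augLinear_apply (z : MonoidAlgebra F W) (O : MulAction.orbitRel.Quotient G W) :
    augLinear F G W z O = ∑ w ∈ z.coeff.support with Quotient.mk'' w = O, z.coeff w := by
  simp [augLinear, Finsupp.mapDomain, Finsupp.sum, Finsupp.single_apply,
    Finset.sum_filter]

variable (G) in
/-- The generalised augmentation map, as a homomorphism of representations (`G` acts trivially on
the target). -/
noncomputable def augmentation :
    Representation.IntertwiningMap (Representation.ofMulAction F G W)
      (Representation.trivial F G (MulAction.orbitRel.Quotient G W → F)) where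
  toLinearMap := augLinear F G W
  isIntertwining' g := by
    ext w O
    have h : (Quotient.mk'' (g • w) : MulAction.orbitRel.Quotient G W) = Quotient.mk'' w :=
      Quotient.sound' (MulAction.orbitRel_apply.mpr (MulAction.mem_orbit w g))
    simp [augLinear, h]

variable (G) in
/-- `Aug⁰(FW)`, the kernel of the generalised augmentation map, as an `FG`-submodule of `FW`. -/
noncomputable def aug0 : Submodule (MonoidAlgebra F G) (PermModule F G W) :=
  (augmentation F G W).ker.asSubmodule

end Modules

end RamseyPerm

/-!
Let `G = Aut M` and write `u ∈ Aug⁰(FW)`, `v ∈ FW`. It is enough to show that, for a suitable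
`g ∈ G`, the element `v + g u` generates both `u` and `v`: the theorem follows by induction on the
number of generators. Two consequences of the Ramsey property, read off in terms of `G`, give this.

*Small values.* Let `τ : F → ℝ/ℤ` be an additive character with `τ 1 ≠ 0`, and let `ε > 0`. There
is a finite set `C`, depending on `u`, `τ` and `ε` only, such that every linear functional `f` on
`FW` satisfies `‖τ (f (g u))‖ < ε` for some `g` moving a fixed finite support `A` of `u` into `C`.
Indeed, the finitely many numbers `τ (α_w f (g w₀))`, where `α_w` is the coefficient of `w` in `u`
and `w₀` represents the orbit of `w`, are coloured by cells of diameter less than `ε / n`. On a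
monochromatic copy, replacing each `w` in the support of `u` by `w₀` changes `τ (f (g u))` by less
than `ε`, and after the replacement the value is `0` because the coefficients of `u` sum to `0` on
every orbit. Composing with a character into a compact group is what makes finitely many colours
suffice for an arbitrary field. This is `IsRamseyStructure.exists_norm_lt`.

*Equal types.* If `A ⊆ C` and `B` are finite, then some `g₀ ∈ G` puts all the copies of `A` in
`g₀ C` into one orbit of the pointwise stabiliser of `B`. Here the colour of a copy of `A` is its
orbit over `B`, and there are finitely many of these by the Ryll-Nardzewski theorem
(`finite_range_tupleOrbit`). This is `IsRamseyStructure.exists_same_orbit`.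

Now let `B` support `v`, take `C` for `ε = ‖τ 1‖`, and let `V` be generated by `z = v + g₀ u`. If
`y A ⊆ C`, some `h` fixing `B` pointwise, hence fixing `v`, agrees with `g₀ y g₀⁻¹` on `g₀ A`, so
`h z - z = g₀ (y u - u)` and `y u ≡ u` modulo `V`. If `u` were not in `V`, there would be a
functional `f` vanishing on `V` with `f u = 1`; then `f (y u) = 1` for all `y` with `y A ⊆ C`,
contradicting `‖τ (f (g u))‖ < ‖τ 1‖` for one of them. So `u ∈ V`, and then `v ∈ V`.

The Ryll-Nardzewski theorem is proved for ultrahomogeneous `M`, where tuples with the same type are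
conjugate. By compactness and categoricity all types are realised in `M`; so a nonempty definable
set contains a definable orbit, and a generic union of finite sets with definable orbits is an
elementary substructure `N`. As `N ≅ M`, all orbits on tuples of `M` are definable, and by
compactness there are finitely many.
-/

namespace RamseyPerm

open FirstOrder Language Set

/-! ### Orbits of tuples in an ω-categorical ultrahomogeneous structure -/

section Categoricity

variable {L : FirstOrder.Language.{u, v}} {M : Type w} [L.Structure M] {α β : Type*}

/-- Compactness: as `M` is, up to isomorphism, the only countable model of its theory, every
family of definable sets with the finite intersection property has a common point in `M` itself. -/
theorem nonempty_iInter_of_definable [Countable L.Symbols] (hM : IsOmegaCategorical L M)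
    [Countable α] {ι : Type*} (D : ι → Set (α → M)) (hD : ∀ i, (∅ : Set M).Definable L (D i))
    (hfin : ∀ s : Finset ι, (⋂ i ∈ s, D i).Nonempty) : (⋂ i, D i).Nonempty := by
  have := hM.infinite
  have := hM.countable
  rcases isEmpty_or_nonempty ι with hι | hι
  · simp
  choose φ hφ using fun i => empty_definable_iff.mp (hD i)
  let T : ι → L[[α]].Theory := fun i =>
    (L.lhomWithConstants α).onTheory (L.completeTheory M) ∪ {Formula.equivSentence (φ i)}
  let T' : L[[α]].Theory := ⋃ i, T i
  have hsat : T'.IsSatisfiable := by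
    rw [Theory.isSatisfiable_iUnion_iff_isSatisfiable_iUnion_finset]
    intro s
    obtain ⟨a, ha⟩ := hfin s
    let _ : (constantsOn α).Structure M := constantsOn.structure a
    have : M ⊨ (⋃ i ∈ s, T i : L[[α]].Theory) := by
      rw [Theory.model_iff]
      intro ψ hψ
      simp only [mem_iUnion, T] at hψ
      obtain ⟨i, hi, hψ | hψ⟩ := hψ
      · exact ((LHom.onTheory_model _ _).2 inferInstance : M ⊨ (L.lhomWithConstants α).onTheory
          (L.completeTheory M)).realize_of_mem ψ hψ
      · rw [mem_singleton_iff] at hψ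
        subst hψ
        have := mem_iInter₂.mp ha i hi
        rw [hφ i] at this
        exact (Formula.realize_equivSentence M (φ i)).mpr this
    exact Theory.Model.isSatisfiable M
  have hsub : (L.lhomWithConstants α).onTheory (L.completeTheory M) ⊆ T' :=
    fun ψ hψ => mem_iUnion.mpr ⟨hι.some, Or.inl hψ⟩
  obtain ⟨N0⟩ := hsat
  have hinf : Infinite N0 := by
    let _ : L.Structure N0 := (L.lhomWithConstants α).reduct N0
    have : (L.lhomWithConstants α).IsExpansionOn N0 := LHom.isExpansionOn_reduct _ _
    have h : N0 ⊨ L.completeTheory M :=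
      (LHom.onTheory_model (L.lhomWithConstants α) _).1 (Theory.Model.mono N0.is_model hsub)
    rw [← model_infiniteTheory_iff (L := L)]
    exact h.mono (Theory.model_iff_subset_completeTheory.mp inferInstance)
  obtain ⟨N, hN⟩ := Theory.exists_model_card_eq ⟨N0, hinf⟩
    (Cardinal.aleph0.{w}) le_rfl (by
      rw [Cardinal.lift_aleph0, Cardinal.lift_le_aleph0]
      exact Cardinal.mk_le_aleph0)
  let _ : L.Structure N := (L.lhomWithConstants α).reduct N
  have : (L.lhomWithConstants α).IsExpansionOn N := LHom.isExpansionOn_reduct _ _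
  have hNT : N ⊨ L.completeTheory M :=
    (LHom.onTheory_model (L.lhomWithConstants α) _).1 (Theory.Model.mono N.is_model hsub)
  obtain ⟨e⟩ := hM.categorical (Theory.ModelType.of _ N) (Theory.ModelType.of _ M) hN
    (Cardinal.mk_eq_aleph0 M)
  let e' : N ≃[L] M := e
  refine ⟨fun a => e' (L.con a : N), mem_iInter.mpr fun i => ?_⟩
  rw [hφ i]
  have h1 : N ⊨ Formula.equivSentence (φ i) :=
    N.is_model.realize_of_mem _ (mem_iUnion.mpr ⟨i, Or.inr rfl⟩)
  rw [Formula.realize_equivSentence] at h1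
  exact (StrongHomClass.realize_formula e' (φ i)).mpr h1

variable (L) in
/-- The orbit of a tuple under the automorphism group. -/
def tupleOrbit (a : α → M) : Set (α → M) := {b | ∃ g : Aut L M, ∀ i, b i = g (a i)}

theorem self_mem_tupleOrbit (a : α → M) : a ∈ tupleOrbit L a := ⟨1, fun _ => rfl⟩

theorem tupleOrbit_comp (a : α → M) (f : β → α) :
    tupleOrbit L (a ∘ f) = (fun b => b ∘ f) '' tupleOrbit L a := by
  ext c
  constructor
  · rintro ⟨g, hg⟩
    exact ⟨fun i => g (a i), ⟨g, fun _ => rfl⟩, funext fun i => (hg i).symm⟩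
  · rintro ⟨b, ⟨g, hg⟩, rfl⟩
    exact ⟨g, fun i => hg _⟩

theorem tupleOrbit_eq_of_mem {a b : α → M} (h : b ∈ tupleOrbit L a) :
    tupleOrbit L b = tupleOrbit L a := by
  obtain ⟨g, hg⟩ := h
  ext c
  constructor
  · rintro ⟨k, hk⟩
    exact ⟨k * g, fun i => by rw [hk, hg]; rfl⟩
  · rintro ⟨k, hk⟩
    refine ⟨k * g⁻¹, fun i => ?_⟩
    rw [hk, hg, aut_mul_apply]
    exact congrArg k (g.symm_apply_apply (a i)).symm

theorem tupleOrbit_subset_of_definable {D : Set (α → M)} (hD : (∅ : Set M).Definable L D)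
    {a : α → M} (ha : a ∈ D) : tupleOrbit L a ⊆ D := by
  rintro b ⟨g, hg⟩
  rw [show b = fun i => g (a i) from funext hg]
  exact (mem_iff_of_definable hD g a).mpr ha

/-- In an ultrahomogeneous structure, finite tuples of the same type over `∅` are conjugate. -/
theorem mem_tupleOrbit_of_definable (hU : L.IsUltrahomogeneous M) [Finite α] {a b : α → M}
    (h : ∀ D : Set (α → M), (∅ : Set M).Definable L D → (a ∈ D ↔ b ∈ D)) :
    b ∈ tupleOrbit L a := by
  have hterm : ∀ x : Substructure.closure L (range a), ∃ t : L.Term α, t.realize a = x := by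
    rintro ⟨x, hx⟩
    obtain ⟨t, rfl⟩ := Substructure.mem_closure_iff_exists_term.mp hx
    refine ⟨t.relabel fun y => y.2.choose, ?_⟩
    rw [Term.realize_relabel]
    congr 1
    ext y
    exact y.2.choose_spec
  choose t ht using hterm
  have heq : ∀ t t' : L.Term α, t.realize a = t'.realize a ↔ t.realize b = t'.realize b :=
    fun t t' => h {c | t.realize c = t'.realize c} (empty_definable_iff.mpr
      ⟨t.equal t', by ext; simp⟩)
  let f : Substructure.closure L (range a) ↪[L] M :=
    { toFun := fun x => (t x).realize b
      inj' := fun x y hxy => Subtype.ext (by rw [← ht x, ← ht y]; exact (heq _ _).mpr hxy)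
      map_fun' := fun {n} F x => by
        refine ((heq (t _) (Term.func F fun i => t (x i))).mp ?_).trans rfl
        rw [ht, Term.realize_func]
        simp only [ht]
        rfl
      map_rel' := fun {n} R x => by
        have := h {c | Structure.RelMap R fun i => (t (x i)).realize c} (empty_definable_iff.mpr
          ⟨R.formula fun i => t (x i), by ext; simp [Formula.realize_rel]⟩)
        simp only [mem_ofPred_eq, ht] at this
        exact this.symm }
  obtain ⟨g, hg⟩ := hU _ (Substructure.fg_closure (finite_range a)) f
  refine ⟨g, fun i => ?_⟩
  have h1 : f ⟨a i, Substructure.subset_closure (mem_range_self i)⟩ = g (a i) := by rw [hg]; rfl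
  rw [← h1]
  exact (heq (Term.var i) _).mp (by rw [ht]; rfl)

/-- Any nonempty definable set contains a definable orbit. Otherwise `D` could be shrunk, through
nonempty definable sets, so as to avoid each of the countably many tuples in turn, contradicting
compactness. -/
theorem exists_mem_definable_tupleOrbit [Countable L.Symbols] (hM : IsOmegaCategorical L M)
    (hU : L.IsUltrahomogeneous M) [Finite α] {D : Set (α → M)} (hD : (∅ : Set M).Definable L D)
    (hne : D.Nonempty) : ∃ a ∈ D, (∅ : Set M).Definable L (tupleOrbit L a) := by
  by_contra! hcon
  have := hM.countable
  have hcount : Countable (α → M) := inferInstance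
  obtain ⟨a, ha⟩ := hne
  have : Nonempty (α → M) := ⟨a⟩
  obtain ⟨e, he⟩ := exists_surjective_nat (α → M)
  let P := {D' : Set (α → M) // D' ⊆ D ∧ D'.Nonempty ∧ (∅ : Set M).Definable L D'}
  have step : ∀ (c : α → M) (D' : P), ∃ D'' : P, D''.1 ⊆ D'.1 ∧ c ∉ D''.1 := by
    rintro c ⟨D', hsub, ⟨b, hb⟩, hdef⟩
    by_cases hc : c ∈ D'
    · obtain ⟨b', hb', hbc⟩ : ∃ b' ∈ D', b' ∉ tupleOrbit L c := by
        by_contra! hall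
        refine hcon c (hsub hc) ?_
        rwa [(tupleOrbit_subset_of_definable hdef hc).antisymm hall]
      have := mt (mem_tupleOrbit_of_definable hU) hbc
      push Not at this
      obtain ⟨X, hX, hX'⟩ := this
      by_cases hcX : c ∈ X
      · have : b' ∉ X := by tauto
        exact ⟨⟨D' ∩ Xᶜ, inter_subset_left.trans hsub, ⟨b', hb', this⟩, hdef.inter hX.compl⟩,
          inter_subset_left, fun h => h.2 hcX⟩
      · have : b' ∈ X := by tauto
        exact ⟨⟨D' ∩ X, inter_subset_left.trans hsub, ⟨b', hb', this⟩, hdef.inter hX⟩,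
          inter_subset_left, fun h => hcX h.2⟩
    · exact ⟨⟨D', hsub, ⟨b, hb⟩, hdef⟩, subset_rfl, hc⟩
  choose next hnext hnext' using step
  let S : ℕ → P := fun n => Nat.rec ⟨D, subset_rfl, ⟨a, ha⟩, hD⟩ (fun n D' => next (e n) D') n
  have hanti : Antitone fun n => (S n).1 := antitone_nat_of_succ_le fun n => hnext (e n) (S n)
  obtain ⟨b, hb⟩ := nonempty_iInter_of_definable hM (fun n => (S n).1) (fun n => (S n).2.2.2)
    fun s => by
      obtain ⟨b, hb⟩ := (S (s.sup id)).2.2.1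
      exact ⟨b, mem_iInter₂.mpr fun i hi => hanti (Finset.le_sup (f := id) hi) hb⟩
  obtain ⟨n, rfl⟩ := he b
  exact hnext' (e n) (S n) (mem_iInter.mp hb (n + 1))

theorem definable_tupleOrbit_of_range_subset [Finite α] [Finite β] {a : α → M} {b : β → M}
    (ha : (∅ : Set M).Definable L (tupleOrbit L a)) (h : range b ⊆ range a) :
    (∅ : Set M).Definable L (tupleOrbit L b) := by
  choose f hf using fun i => h (mem_range_self i)
  rw [show b = a ∘ f from funext fun i => (hf i).symm, tupleOrbit_comp]
  exact ha.image_comp f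

/-- A finite set with definable orbit can be enlarged by a witness of a formula satisfiable over it,
keeping the orbit definable. -/
theorem exists_insert_definable_tupleOrbit [DecidableEq M] [Countable L.Symbols]
    (hM : IsOmegaCategorical L M)
    (hU : L.IsUltrahomogeneous M) {s t : Finset M} (hst : s ⊆ t)
    (ht : (∅ : Set M).Definable L (tupleOrbit L (Subtype.val : t → M)))
    (φ : L.Formula (s ⊕ Fin 1)) {b : M} (hb : φ.Realize (Sum.elim Subtype.val fun _ => b)) :
    ∃ c : M, φ.Realize (Sum.elim Subtype.val fun _ => c) ∧
      (∅ : Set M).Definable L (tupleOrbit L (Subtype.val : ↥(insert c t) → M)) := by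
  let incl : s → t := fun i => ⟨i, hst i.2⟩
  let D : Set (t ⊕ Fin 1 → M) := (fun c => c ∘ Sum.inl) ⁻¹' (tupleOrbit L (Subtype.val : t → M)) ∩
    {c | (φ.relabel (Sum.map incl id)).Realize c}
  have hD : (∅ : Set M).Definable L D :=
    (ht.preimage_comp Sum.inl).inter (empty_definable_iff.mpr ⟨_, rfl⟩)
  obtain ⟨c, ⟨⟨g, hg⟩, hc⟩, hc'⟩ := exists_mem_definable_tupleOrbit hM hU hD
    ⟨Sum.elim Subtype.val fun _ => b, self_mem_tupleOrbit _, by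
      rw [mem_ofPred_eq, Formula.realize_relabel]
      convert hb using 1
      ext (i | i) <;> rfl⟩
  have hval : ∀ i : t, g⁻¹ (c (Sum.inl i)) = i := fun i => by
    rw [show c (Sum.inl i) = g i from hg i]
    exact g.symm_apply_apply _
  refine ⟨g⁻¹ (c (Sum.inr 0)), ?_, ?_⟩
  · rw [mem_ofPred_eq, Formula.realize_relabel] at hc
    rw [← StrongHomClass.realize_formula (g⁻¹ : Aut L M)] at hc
    convert hc using 1
    ext (i | i)
    · exact (hval (incl i)).symm
    · rw [Subsingleton.elim i 0]
      rfl
  · have : tupleOrbit L c = tupleOrbit L fun i => g⁻¹ (c i) :=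
      (tupleOrbit_eq_of_mem ⟨g⁻¹, fun _ => rfl⟩).symm
    rw [this] at hc'
    refine definable_tupleOrbit_of_range_subset hc' ?_
    rintro _ ⟨⟨x, hx⟩, rfl⟩
    rcases Finset.mem_insert.mp hx with rfl | hx
    · exact ⟨Sum.inr 0, rfl⟩
    · exact ⟨Sum.inl ⟨x, hx⟩, hval ⟨x, hx⟩⟩

/-- There is an atomic elementary substructure, given here by its underlying set `N`: it is the
union of an ideal, in the poset of finite sets with definable orbit, that is generic for the
countably many Tarski–Vaught conditions. -/
theorem exists_meetsDefinable_definable_tupleOrbit [Countable L.Symbols]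
    (hM : IsOmegaCategorical L M) (hU : L.IsUltrahomogeneous M) :
    ∃ N : Set M, L.MeetsDefinable N ∧ ∀ s : Finset M, (s : Set M) ⊆ N →
      (∅ : Set M).Definable L (tupleOrbit L (Subtype.val : s → M)) := by
  classical
  have := hM.countable
  let P := {s : Finset M // (∅ : Set M).Definable L (tupleOrbit L (Subtype.val : s → M))}
  let ι := Σ s : Finset M, L.Formula (s ⊕ Fin 1)
  have : Encodable ι := Encodable.ofCountable ι
  let 𝒟 : ι → Order.Cofinal P := fun i =>
    -- The first alternative is not that `i.1` is absent from `t`: it has to persist in larger sets.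
    { carrier := {t | (∀ t' ≥ t, ¬ i.1 ⊆ t'.1) ∨
        (∀ b : M, ¬ i.2.Realize (Sum.elim Subtype.val fun _ => b)) ∨
        ∃ b ∈ t.1, i.2.Realize (Sum.elim Subtype.val fun _ => b)}
      isCofinal := fun t => by
        by_cases h : ∃ t' ≥ t, i.1 ⊆ t'.1
        · obtain ⟨t', htt', hi⟩ := h
          by_cases hb : ∃ b : M, i.2.Realize (Sum.elim Subtype.val fun _ => b)
          · obtain ⟨b, hb⟩ := hb
            obtain ⟨c, hc, hc'⟩ := exists_insert_definable_tupleOrbit hM hU hi t'.2 i.2 hb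
            exact ⟨⟨insert c t'.1, hc'⟩, Or.inr (Or.inr ⟨c, Finset.mem_insert_self _ _, hc⟩),
              htt'.trans (Finset.subset_insert c t'.1)⟩
          · exact ⟨t, Or.inr (Or.inl (not_exists.mp hb)), le_rfl⟩
        · push Not at h
          exact ⟨t, Or.inl h, le_rfl⟩ }
  obtain ⟨a, -, ha⟩ := exists_mem_definable_tupleOrbit hM hU
    (definable_univ (L := L) (M := M) (α := (∅ : Finset M))) ⟨Subtype.val, mem_univ _⟩
  have hp : (∅ : Set M).Definable L (tupleOrbit L (Subtype.val : ↥(∅ : Finset M) → M)) := by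
    rwa [Subsingleton.elim Subtype.val a]
  let I := Order.idealOfCofinals (⟨∅, hp⟩ : P) 𝒟
  let N : Set M := {x | ∃ s ∈ I, x ∈ s.1}
  have hN : ∀ s : Finset M, (s : Set M) ⊆ N → ∃ t ∈ I, s ⊆ t.1 := by
    intro s
    induction s using Finset.induction_on with
    | empty => exact fun _ => ⟨_, Order.mem_idealOfCofinals _ _, Finset.empty_subset _⟩
    | insert x s _ ih =>
      intro h
      rw [Finset.coe_insert, insert_subset_iff] at h
      obtain ⟨t, ht, hst⟩ := ih h.2
      obtain ⟨t', ht', hxt⟩ := h.1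
      obtain ⟨t'', ht'', h1, h2⟩ := I.directed t ht t' ht'
      exact ⟨t'', ht'', Finset.insert_subset (h2 hxt) (hst.trans h1)⟩
  refine ⟨N, ?_, fun s hs => ?_⟩
  · rintro D ⟨d, hd⟩ hD
    obtain ⟨s, hsN, hs⟩ := definable_iff_finitely_definable.mp hD
    obtain ⟨φ, hφ⟩ := definable_iff_exists_formula_sum.mp hs
    have hφ' : ∀ b : M, b ∈ D ↔ φ.Realize (Sum.elim Subtype.val fun _ => b) := fun b =>
      Set.ext_iff.mp hφ fun _ => b
    obtain ⟨t, htI, hst⟩ := hN s hsN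
    obtain ⟨t', ht', htI'⟩ := Order.cofinal_meets_idealOfCofinals (⟨∅, hp⟩ : P) 𝒟 ⟨s, φ⟩
    obtain ⟨t'', ht'', h1, h2⟩ := I.directed t htI t' htI'
    rcases ht' with h | h | ⟨b, hb, hbφ⟩
    · exact absurd (hst.trans h1) (h t'' h2)
    · exact absurd ((hφ' d).mp hd) (h d)
    · exact ⟨b, (hφ' b).mpr hbφ, t', htI', hb⟩
  · obtain ⟨t, -, hst⟩ := hN s hs
    refine definable_tupleOrbit_of_range_subset t.2 ?_
    rintro _ ⟨x, rfl⟩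
    exact ⟨⟨x, hst x.2⟩, rfl⟩

/-- All orbits on finite tuples are definable, because `M` is isomorphic to an atomic elementary
substructure of itself. -/
theorem definable_tupleOrbit [Countable L.Symbols] (hM : IsOmegaCategorical L M)
    (hU : L.IsUltrahomogeneous M) [Finite α] (a : α → M) :
    (∅ : Set M).Definable L (tupleOrbit L a) := by
  classical
  have := hM.countable
  have := hM.infinite
  obtain ⟨N, hN, hdef⟩ := exists_meetsDefinable_definable_tupleOrbit hM hU
  let S := hN.toElementarySubstructure
  have hS : Infinite S := S.subtype.elementarilyEquivalent.infinite_iff.mpr inferInstance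
  have hSM : S ⊨ L.completeTheory M := S.subtype.elementarilyEquivalent.symm.theory_model
  have := hS.nonempty
  obtain ⟨e⟩ := hM.categorical (Theory.ModelType.of _ M) (Theory.ModelType.of _ S)
    (Cardinal.mk_eq_aleph0 M) (Cardinal.mk_eq_aleph0 S)
  let e' : M ≃[L] S := e
  let b : α → M := fun i => e' (a i)
  have hbN : range b ⊆ N := by
    rintro _ ⟨i, rfl⟩
    have : (b i) ∈ Substructure.closure L N := (e' (a i)).2
    rwa [← SetLike.mem_coe, hN.closure_eq_self] at this
  have hb : (∅ : Set M).Definable L (tupleOrbit L b) :=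
    definable_tupleOrbit_of_range_subset (hdef (finite_range b).toFinset (by simpa using hbN))
      (by rw [Subtype.range_coe_subtype]; simp [range])
  obtain ⟨φ, hφ⟩ := empty_definable_iff.mp hb
  have h1 : φ.Realize b := (Set.ext_iff.mp hφ b).mp (self_mem_tupleOrbit b)
  have h2 : φ.Realize a := by
    rw [← StrongHomClass.realize_formula e', ← S.subtype.map_formula]
    exact h1
  rwa [tupleOrbit_eq_of_mem ((Set.ext_iff.mp hφ a).mpr h2)]

/-- **Ryll-Nardzewski theorem** for ultrahomogeneous structures: there are finitely many orbits on
`α`-tuples, for finite `α`. -/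
theorem finite_range_tupleOrbit [Countable L.Symbols] (hM : IsOmegaCategorical L M)
    (hU : L.IsUltrahomogeneous M) [Finite α] :
    (range (tupleOrbit L : (α → M) → Set (α → M))).Finite := by
  classical
  have := hM.countable
  by_contra hinf
  obtain ⟨b, hb⟩ := nonempty_iInter_of_definable hM (fun a : α → M => (tupleOrbit L a)ᶜ)
    (fun a => (definable_tupleOrbit hM hU a).compl) fun s => by
      obtain ⟨_, ⟨b, rfl⟩, hb⟩ := Set.Infinite.exists_notMem_finset hinf (s.image (tupleOrbit L))
      refine ⟨b, mem_iInter₂.mpr fun a ha hab => hb ?_⟩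
      rw [tupleOrbit_eq_of_mem hab]
      exact Finset.mem_image_of_mem _ ha
  exact mem_iInter.mp hb b (self_mem_tupleOrbit b)

end Categoricity

/-! ### The Ramsey property in terms of automorphisms -/

section Ramsey

variable {L : FirstOrder.Language.{u, v}} {M : Type w} [L.Structure M]

theorem IsRamseyStructure.exists_aut_extending (hR : IsRamseyStructure L M)
    {A : L.Substructure M} (hA : (A : Set M).Finite) (f : A ↪[L] M) :
    ∃ g : Aut L M, ∀ a : A, g a = f a := by
  have : Finite A := hA
  obtain ⟨g, hg⟩ := hR.ultrahomogeneous A Substructure.FG.of_finite f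
  exact ⟨g, fun a => by rw [hg]; rfl⟩

theorem mem_age_of_finite {A : L.Substructure M} (hA : (A : Set M).Finite) :
    (⟨A, inferInstance⟩ : CategoryTheory.Bundled.{w} L.Structure) ∈ L.age M := by
  have : Finite A := hA
  exact ⟨Structure.FG.of_finite, ⟨A.subtype⟩⟩

/-- The Ramsey property in terms of the automorphism group. As `A` is rigid and every embedding of
`A` into `M` extends to an automorphism, copies of `A` in `M` correspond to automorphisms up to
agreement on `A`, so a colouring of the copies is a map `χ` respecting agreement on `A`. -/
theorem IsRamseyStructure.exists_monochromatic (hR : IsRamseyStructure L M)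
    {A B : L.Substructure M} (hA : (A : Set M).Finite) (hB : (B : Set M).Finite) (hAB : A ≤ B)
    (κ : Type*) [Finite κ] :
    ∃ C : Set M, C.Finite ∧ ∀ χ : Aut L M → κ,
      (∀ g h : Aut L M, (∀ a ∈ A, g a = h a) → χ g = χ h) →
      ∃ g : Aut L M, (∀ b ∈ B, g b ∈ C) ∧ ∀ x y : Aut L M,
        (∀ a ∈ A, x a ∈ B) → (∀ a ∈ A, y a ∈ B) → χ (g * x) = χ (g * y) := by
  obtain ⟨k, ⟨eκ⟩⟩ := Finite.exists_equiv_fin κ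
  let ι := Substructure.inclusion hAB
  let eA : A ≃[L] ι.toHom.range := ι.equivRange
  obtain ⟨C, hC, -, hcol⟩ := hR.isRamseyClass.ramsey _ (mem_age_of_finite hB) ι.toHom.range k
  have hCfin : Finite C := hR.isRamseyClass.finite C hC
  obtain ⟨j⟩ := hC.2
  refine ⟨range j, finite_range j, fun χ hχ => ?_⟩
  have he : ∀ A' : copies L ι.toHom.range C, Nonempty (ι.toHom.range ≃[L] A'.1) := fun A' => A'.2
  let e := fun A' => (he A').some
  choose ψ hψ using fun A' : copies L ι.toHom.range C => hR.exists_aut_extending hA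
    (j.comp (A'.1.subtype.comp ((e A').toEmbedding.comp eA.toEmbedding)))
  obtain ⟨B', ⟨β⟩, hB'⟩ := hcol fun A' => eκ (χ (ψ A'))
  obtain ⟨g, hg⟩ := hR.exists_aut_extending hB (j.comp (B'.subtype.comp β.toEmbedding))
  refine ⟨g, fun b hb => ⟨_, (hg ⟨b, hb⟩).symm⟩, ?_⟩
  -- The image in `B'` of the copy `x A` is a copy of `A` in `C` whose colour is that of `g * x`.
  have key : ∀ x : Aut L M, (∀ a ∈ A, x a ∈ B) →
      ∃ A' : copies L ι.toHom.range C, A'.1 ≤ B' ∧ χ (g * x) = χ (ψ A') := by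
    intro x hx
    let ξ : A ↪[L] C := B'.subtype.comp (β.toEmbedding.comp
      (Embedding.codRestrict B (x.toEmbedding.comp A.subtype) fun a => hx a a.2))
    let R : copies L ι.toHom.range C := ⟨ξ.toHom.range, ⟨ξ.equivRange.comp eA.symm⟩⟩
    refine ⟨R, ?_, hχ _ _ fun a ha => ?_⟩
    · rintro _ ⟨a, rfl⟩
      exact (β _).2
    · -- By rigidity the chosen isomorphism from `A` onto this copy is the one induced by `x`.
      have h := hR.rigid _ (mem_age_of_finite hA) (ξ.equivRange.symm.comp ((e R).comp eA))
      have h' : ξ.equivRange.symm (e R (eA ⟨a, ha⟩)) = ⟨a, ha⟩ := DFunLike.congr_fun h _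
      have h'' : e R (eA ⟨a, ha⟩) = ξ.equivRange ⟨a, ha⟩ := by
        rw [← ξ.equivRange.apply_symm_apply (e R (eA ⟨a, ha⟩)), h']
      rw [aut_mul_apply]
      refine (hg ⟨x a, hx a ha⟩).trans (Eq.trans ?_ (hψ R ⟨a, ha⟩).symm)
      exact congrArg j (congrArg Subtype.val h'').symm
  intro x y hx hy
  obtain ⟨X, hX, hX'⟩ := key x hx
  obtain ⟨Y, hY, hY'⟩ := key y hy
  rw [hX', hY']
  exact eκ.injective (hB' X Y hX hY)

/-- Some translate `g C` has all its copies of `A` in the same orbit of the pointwise stabiliser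
of `B`. -/
theorem IsRamseyStructure.exists_same_orbit [Countable L.Symbols] (hM : IsOmegaCategorical L M)
    (hR : IsRamseyStructure L M) {A C : L.Substructure M} (hA : (A : Set M).Finite)
    (hC : (C : Set M).Finite) (hAC : A ≤ C) {B : Set M} (hB : B.Finite) :
    ∃ g : Aut L M, ∀ x y : Aut L M, (∀ a ∈ A, x a ∈ C) → (∀ a ∈ A, y a ∈ C) →
      ∃ h : Aut L M, (∀ b ∈ B, h b = b) ∧ ∀ a ∈ A, h (g (x a)) = g (y a) := by
  have : Finite A := hA
  have : Finite B := hB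
  have := (finite_range_tupleOrbit (α := B ⊕ A) hM hR.ultrahomogeneous).to_subtype
  obtain ⟨_, -, hcol⟩ := hR.exists_monochromatic hA hC hAC
    (range (tupleOrbit L : (B ⊕ A → M) → Set (B ⊕ A → M)))
  obtain ⟨g, -, hg⟩ := hcol
    (fun g => ⟨tupleOrbit L (Sum.elim Subtype.val fun a => g a), mem_range_self _⟩)
    fun g h hgh => by
      have : (fun a : A => g a) = fun a : A => h a := funext fun a => hgh a a.2
      simp only [this]
  refine ⟨g, fun x y hx hy => ?_⟩
  have h := self_mem_tupleOrbit (L := L)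
    (Sum.elim (Subtype.val : B → M) fun a : A => (g * y) a)
  have heq : tupleOrbit L (Sum.elim (Subtype.val : B → M) fun a : A => (g * x) a) =
      tupleOrbit L (Sum.elim (Subtype.val : B → M) fun a : A => (g * y) a) :=
    congrArg Subtype.val (hg x y hx hy)
  rw [← heq] at h
  obtain ⟨h, hh⟩ := h
  exact ⟨h, fun b hb => (hh (Sum.inl ⟨b, hb⟩)).symm, fun a ha => (hh (Sum.inr ⟨a, ha⟩)).symm⟩

end Ramsey

/-! ### Additive characters and finite colourings of compact spaces -/

section Colouring

/-- Characters with values in `ℝ / ℤ` separate points; unlike `ℚ / ℤ`, this group is compact. -/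
theorem exists_addMonoidHom_unitAddCircle_ne_zero {A : Type*} [AddCommGroup A] {a : A}
    (ha : a ≠ 0) : ∃ τ : A →+ UnitAddCircle, τ a ≠ 0 := by
  obtain ⟨c, hc⟩ := CharacterModule.exists_character_apply_ne_zero_of_ne_zero ha
  let ι : AddCircle (1 : ℚ) →+ UnitAddCircle := QuotientAddGroup.map _ _
    (Rat.castHom ℝ).toAddMonoidHom (by
      rw [AddSubgroup.zmultiples_le, AddSubgroup.mem_comap]
      simp)
  have hι : ∀ q, ι q = 0 → q = 0 := by
    intro q
    induction q using QuotientAddGroup.induction_on with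
    | H q =>
      intro h
      have h' : ((q : ℝ) : UnitAddCircle) = 0 := h
      rw [AddCircle.coe_eq_zero_iff] at h'
      obtain ⟨n, hn⟩ := h'
      refine (AddCircle.coe_eq_zero_iff (1 : ℚ)).mpr ⟨n, ?_⟩
      rw [zsmul_one] at hn ⊢
      exact_mod_cast hn
  exact ⟨ι.comp c, fun h => hc (hι _ h)⟩

theorem exists_finite_colouring_dist_lt (X : Type*) [PseudoMetricSpace X] [CompactSpace X]
    {ε : ℝ} (hε : 0 < ε) :
    ∃ (k : ℕ) (c : X → Fin k), ∀ x y, c x = c y → dist x y < ε := by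
  obtain ⟨t, -, htf, ht⟩ :=
    finite_cover_balls_of_compact (isCompact_univ (X := X)) (half_pos hε)
  have := htf.to_subtype
  obtain ⟨k, ⟨e⟩⟩ := Finite.exists_equiv_fin t
  have h : ∀ x : X, ∃ y : t, dist x y < ε / 2 := fun x => by
    have := ht (mem_univ x)
    simp only [mem_iUnion, Metric.mem_ball] at this
    obtain ⟨y, hy, h⟩ := this
    exact ⟨⟨y, hy⟩, h⟩
  choose f hf using h
  refine ⟨k, fun x => e (f x), fun x y hxy => ?_⟩
  have h1 := hf x
  have h2 := hf y
  rw [e.injective hxy] at h1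
  linarith [dist_triangle_right x y (f y : X)]

end Colouring

/-! ### Permutation modules of a Ramsey structure -/

section PermutationModules

variable {L : FirstOrder.Language.{u, v}} {M : Type w} [L.Structure M]

variable (L) in
/-- The set `A` supports the point `x` of an `Aut L M`-set: the pointwise stabiliser of `A` fixes
`x`. -/
def Supports {X : Type*} [MulAction (Aut L M) X] (A : Set M) (x : X) : Prop :=
  ∀ h : Aut L M, (∀ a ∈ A, h a = a) → h • x = x

section Supports

variable {X : Type*} [MulAction (Aut L M) X] {A B : Set M} {x : X}

theorem Supports.mono (h : Supports L A x) (hAB : A ⊆ B) : Supports L B x :=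
  fun g hg => h g fun a ha => hg a (hAB ha)

theorem Supports.smul_eq_smul (h : Supports L A x) {f g : Aut L M} (hfg : ∀ a ∈ A, f a = g a) :
    f • x = g • x := by
  rw [eq_comm, ← inv_smul_eq_iff, ← mul_smul]
  refine h _ fun a ha => ?_
  rw [aut_mul_apply, ← hfg a ha]
  exact f.symm_apply_apply a

theorem exists_finite_supports_meq (e : Meq L M) : ∃ A : Set M, A.Finite ∧ Supports L A e := by
  obtain ⟨s, q⟩ := e
  induction q using Quotient.inductionOn with
  | h a =>
    refine ⟨range a.1, finite_range _, fun h hh => ?_⟩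
    have : s.domMap h a = a := Subtype.ext (funext fun i => hh _ (mem_range_self i))
    change (⟨s, Quotient.mk _ (s.domMap h a)⟩ : Meq L M) = _
    rw [this]

theorem exists_finite_supports_of_finite {I : Set X} (hI : I.Finite)
    (hX : ∀ x : X, ∃ A : Set M, A.Finite ∧ Supports L A x) :
    ∃ A : Set M, A.Finite ∧ ∀ x ∈ I, Supports L A x := by
  choose A hA hAx using hX
  exact ⟨⋃ x ∈ I, A x, hI.biUnion fun x _ => hA x,
    fun x hx => (hAx x).mono (subset_biUnion_of_mem hx)⟩

end Supports

variable {F : Type x} [Field F] {X : Type*} [MulAction (Aut L M) X]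

open Classical in
/-- For a combination `z` of points whose coefficients sum to `0` on each orbit, and a function `μ`
extended linearly, some translate of `z` has value close to `0` after applying `τ`. The finite set
`C` that this translate stays in does not depend on `μ`. -/
theorem IsRamseyStructure.exists_norm_lt (hR : IsRamseyStructure L M)
    (τ : F →+ UnitAddCircle) {ε : ℝ} (hε : 0 < ε) (z : X →₀ F)
    (hz : ∀ O : MulAction.orbitRel.Quotient (Aut L M) X,
      ∑ w ∈ z.support with Quotient.mk'' w = O, z w = 0)
    {A : L.Substructure M} (hA : (A : Set M).Finite)
    (hsupp : ∀ w ∈ z.support, Supports L (A : Set M)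
      (Quotient.mk'' w : MulAction.orbitRel.Quotient (Aut L M) X).out) :
    ∃ C : Set M, C.Finite ∧ ∀ μ : X → F, ∃ g : Aut L M, (∀ a ∈ A, g a ∈ C) ∧
      ‖τ (∑ w ∈ z.support, z w * μ (g • w))‖ < ε := by
  let r : X → X := fun w => (Quotient.mk'' w : MulAction.orbitRel.Quotient (Aut L M) X).out
  have hr : ∀ w, ∃ y : Aut L M, y • r w = w := fun w => by
    have : MulAction.orbitRel (Aut L M) X w (r w) :=
      Setoid.symm' _ (Quotient.exact' (Quotient.out_eq' _))
    exact MulAction.orbitRel_apply.mp this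
  choose y hy using hr
  -- One more than the number of error terms, so that `n` is positive and their sum is below `ε`.
  let n : ℝ := z.support.card + 1
  have hn : 0 < n := by positivity
  obtain ⟨k, c, hc⟩ := exists_finite_colouring_dist_lt UnitAddCircle (div_pos hε hn)
  let B : L.Substructure M :=
    Substructure.closure L (A ∪ ⋃ w ∈ z.support, y w '' A)
  have hB : (B : Set M).Finite := hR.locallyFinite _
    (hA.union (z.support.finite_toSet.biUnion fun w _ => hA.image _))
  have hAB : A ≤ B := fun a ha => Substructure.subset_closure (Or.inl ha)
  have hyB : ∀ w ∈ z.support, ∀ a ∈ A, y w a ∈ B := fun w hw a ha =>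
    Substructure.subset_closure (Or.inr (mem_biUnion hw ⟨a, ha, rfl⟩))
  obtain ⟨C, hC, hcol⟩ := hR.exists_monochromatic hA hB hAB (z.support → Fin k)
  refine ⟨C, hC, fun μ => ?_⟩
  obtain ⟨g, hgC, hg⟩ := hcol (fun g w => c (τ (z w * μ (g • r w)))) fun g h hgh => by
    funext w
    rw [(hsupp w w.2).smul_eq_smul hgh]
  refine ⟨g, fun a ha => hgC a (hAB ha), ?_⟩
  have hsum : ∑ w ∈ z.support, z w * μ (g • r w) = 0 := by
    rw [← Finset.sum_fiberwise_of_maps_to (t := z.support.image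
      (Quotient.mk'' : X → MulAction.orbitRel.Quotient (Aut L M) X))
      fun w hw => Finset.mem_image_of_mem _ hw]
    refine Finset.sum_eq_zero fun O _ => ?_
    rw [← zero_mul (μ (g • O.out)), ← hz O, Finset.sum_mul]
    refine Finset.sum_congr rfl fun w hw => ?_
    rw [← (Finset.mem_filter.mp hw).2]
  have hclose : ∀ w ∈ z.support,
      ‖τ (z w * μ (g • w)) - τ (z w * μ (g • r w))‖ ≤ ε / n := by
    intro w hw
    have h := congrFun (hg (y w) 1 (hyB w hw) fun a ha => hAB ha) ⟨w, hw⟩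
    have h' := hc _ _ h
    rw [dist_eq_norm, mul_smul, hy, mul_one] at h'
    exact h'.le
  rw [← sub_zero (τ _), ← map_zero τ, ← hsum, map_sum, map_sum, ← Finset.sum_sub_distrib]
  calc _ ≤ ∑ w ∈ z.support, ε / n := (norm_sum_le _ _).trans (Finset.sum_le_sum hclose)
    _ = z.support.card * (ε / n) := by rw [Finset.sum_const, nsmul_eq_mul]
    _ < n * (ε / n) := by
      refine mul_lt_mul_of_pos_right ?_ (div_pos hε hn)
      simp [n]
    _ = ε := mul_div_cancel₀ _ hn.ne'

theorem asModuleEquiv_of_smul (g : Aut L M) (u : PermModule F (Aut L M) X) :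
    (Representation.ofMulAction F (Aut L M) X).asModuleEquiv
      (MonoidAlgebra.of F (Aut L M) g • u) =
    ∑ w ∈ ((Representation.ofMulAction F (Aut L M) X).asModuleEquiv u).coeff.support,
      MonoidAlgebra.single (g • w)
        (((Representation.ofMulAction F (Aut L M) X).asModuleEquiv u).coeff w) := by
  rw [Representation.asModuleEquiv_map_smul, Representation.asAlgebraHom_of]
  conv_lhs =>
    rw [← ((Representation.ofMulAction F (Aut L M) X).asModuleEquiv u).sum_coeff_single]
  rw [Finsupp.sum, map_sum]
  simp only [Representation.ofMulAction_single]

theorem of_smul_eq_of_smul {A : Set M} {u : PermModule F (Aut L M) X}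
    (hA : ∀ w ∈ ((Representation.ofMulAction F (Aut L M) X).asModuleEquiv u).coeff.support,
      Supports L A w) {f g : Aut L M} (hfg : ∀ a ∈ A, f a = g a) :
    MonoidAlgebra.of F (Aut L M) f • u = MonoidAlgebra.of F (Aut L M) g • u := by
  apply (Representation.ofMulAction F (Aut L M) X).asModuleEquiv.injective
  rw [asModuleEquiv_of_smul, asModuleEquiv_of_smul]
  exact Finset.sum_congr rfl fun w hw => by rw [(hA w hw).smul_eq_smul hfg]

theorem map_of_smul (g : Aut L M) (u : PermModule F (Aut L M) X)
    (f : PermModule F (Aut L M) X →ₗ[F] F) :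
    f (MonoidAlgebra.of F (Aut L M) g • u) =
    ∑ w ∈ ((Representation.ofMulAction F (Aut L M) X).asModuleEquiv u).coeff.support,
      ((Representation.ofMulAction F (Aut L M) X).asModuleEquiv u).coeff w *
        f ((Representation.ofMulAction F (Aut L M) X).asModuleEquiv.symm
          (MonoidAlgebra.single (g • w) 1)) := by
  rw [← (Representation.ofMulAction F (Aut L M) X).asModuleEquiv.symm_apply_apply
    (MonoidAlgebra.of F (Aut L M) g • u), asModuleEquiv_of_smul, map_sum, map_sum]
  refine Finset.sum_congr rfl fun w _ => ?_
  rw [← smul_eq_mul, ← map_smul, ← map_smul, MonoidAlgebra.smul_single, smul_eq_mul, mul_one]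

/-- Adding to `v` a suitable translate of an element `u` of the generalised augmentation kernel gives
an element that generates `u`. -/
theorem IsRamseyStructure.exists_mem_span_singleton [Countable L.Symbols]
    (hM : IsOmegaCategorical L M) (hR : IsRamseyStructure L M)
    (hX : ∀ x : X, ∃ A : Set M, A.Finite ∧ Supports L A x)
    {u : PermModule F (Aut L M) X} (hu : u ∈ aug0 F (Aut L M) X) (v : PermModule F (Aut L M) X) :
    ∃ g : Aut L M, u ∈ Submodule.span (MonoidAlgebra F (Aut L M))
      {v + MonoidAlgebra.of F (Aut L M) g • u} := by
  classical
  set e := (Representation.ofMulAction F (Aut L M) X).asModuleEquiv with he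
  obtain ⟨τ, hτ⟩ := exists_addMonoidHom_unitAddCircle_ne_zero (one_ne_zero (α := F))
  obtain ⟨A₀, hA₀, hA₀u⟩ := exists_finite_supports_of_finite (L := L) (M := M)
    ((e u).coeff.support.finite_toSet.union ((e u).coeff.support.finite_toSet.image fun w =>
      (Quotient.mk'' w : MulAction.orbitRel.Quotient (Aut L M) X).out)) hX
  obtain ⟨B, hB, hBv⟩ := exists_finite_supports_of_finite (L := L) (M := M)
    (e v).coeff.support.finite_toSet hX
  let A : L.Substructure M := Substructure.closure L A₀
  have hA : (A : Set M).Finite := hR.locallyFinite _ hA₀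
  have hA₀A : A₀ ⊆ A := Substructure.subset_closure
  have hz : ∀ O : MulAction.orbitRel.Quotient (Aut L M) X,
      ∑ w ∈ (e u).coeff.support with Quotient.mk'' w = O, (e u).coeff w = 0 := by
    intro O
    have h : augLinear F (Aut L M) X (e u) = 0 := hu
    rw [← augLinear_apply, h]
    rfl
  obtain ⟨C₀, hC₀, hCu⟩ := hR.exists_norm_lt τ (norm_pos_iff.mpr hτ) (e u).coeff hz hA
    fun w hw => (hA₀u _ (Or.inr ⟨w, hw, rfl⟩)).mono hA₀A
  let C : L.Substructure M := Substructure.closure L (A ∪ C₀)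
  have hC : (C : Set M).Finite := hR.locallyFinite _ (hA.union hC₀)
  have hAC : A ≤ C := fun a ha => Substructure.subset_closure (Or.inl ha)
  obtain ⟨g₀, hg₀⟩ := hR.exists_same_orbit hM hA hC hAC hB
  refine ⟨g₀, ?_⟩
  set V := Submodule.span (MonoidAlgebra F (Aut L M))
    {v + MonoidAlgebra.of F (Aut L M) g₀ • u} with hV
  have hAu : ∀ w ∈ (e u).coeff.support, Supports L (A : Set M) w :=
    fun w hw => (hA₀u w (Or.inl hw)).mono hA₀A
  have hmem : ∀ y : Aut L M, (∀ a ∈ A, y a ∈ C) → MonoidAlgebra.of F (Aut L M) y • u - u ∈ V := by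
    intro y hy
    obtain ⟨h, hhB, hhA⟩ := hg₀ 1 y (fun a ha => hAC ha) hy
    have hv : MonoidAlgebra.of F (Aut L M) h • v = v := by
      rw [of_smul_eq_of_smul (g := 1) hBv hhB, map_one, one_smul]
    have hu' : MonoidAlgebra.of F (Aut L M) (h * g₀) • u =
        MonoidAlgebra.of F (Aut L M) (g₀ * y) • u := of_smul_eq_of_smul hAu hhA
    have hmemz : v + MonoidAlgebra.of F (Aut L M) g₀ • u ∈ V := Submodule.mem_span_singleton_self _
    have key := V.smul_mem (MonoidAlgebra.of F (Aut L M) g₀⁻¹)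
      (V.sub_mem (V.smul_mem (MonoidAlgebra.of F (Aut L M) h) hmemz) hmemz)
    rw [smul_add, hv, smul_smul, ← map_mul, hu', add_sub_add_left_eq_sub, smul_sub, smul_smul,
      smul_smul, ← map_mul, ← map_mul, inv_mul_cancel_left, inv_mul_cancel, map_one, one_smul] at key
    exact key
  by_contra hcon
  obtain ⟨f, hfu, hfV⟩ := Submodule.exists_le_ker_of_notMem (K := F)
    (p := V.restrictScalars F) (v := u) hcon
  let f' := (f u)⁻¹ • f
  have hf'u : f' u = 1 := inv_mul_cancel₀ hfu
  obtain ⟨g, hgC, hg⟩ := hCu fun x => f' (e.symm (MonoidAlgebra.single x 1))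
  rw [← map_of_smul] at hg
  have h1 : f (MonoidAlgebra.of F (Aut L M) g • u - u) = 0 :=
    hfV (hmem g fun a ha => Substructure.subset_closure (Or.inr (hgC a ha)))
  have h2 : f' (MonoidAlgebra.of F (Aut L M) g • u) = 1 := by
    rw [← hf'u, ← sub_eq_zero, ← map_sub]
    change (f u)⁻¹ * _ = 0
    rw [h1, mul_zero]
  rw [h2] at hg
  exact lt_irrefl _ hg

end PermutationModules

end RamseyPerm


open RamseyPerm in
theorem theorem3p7 {L : FirstOrder.Language.{u, v}} [Countable L.Symbols] {M : Type w} [L.Structure M]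
    (hM : IsOmegaCategorical L M) (hR : IsRamseyStructure L M)
    (F : Type x) [Field F]
    (W : SubMulAction (Aut L M) (Meq L M))
    (hW : ∃ T : Set (Meq L M), T.Finite ∧
      (W : Set (Meq L M)) = ⋃ e ∈ T, MulAction.orbit (Aut L M) e)
    (V : Submodule (MonoidAlgebra F (Aut L M)) (PermModule F (Aut L M) W))
    (hV : V ≤ aug0 F (Aut L M) W) (hfg : V.FG) :
    ∃ z : PermModule F (Aut L M) W, V = Submodule.span (MonoidAlgebra F (Aut L M)) {z} := by
  have hX : ∀ x : W, ∃ A : Set M, A.Finite ∧ Supports L A x := fun x => by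
    obtain ⟨A, hA, h⟩ := exists_finite_supports_meq x.1
    exact ⟨A, hA, fun g hg => Subtype.ext (h g hg)⟩
  induction V, hfg using Submodule.fg_induction with
  | singleton z => exact ⟨z, rfl⟩
  | sup V₁ V₂ _ _ h₁ h₂ =>
    obtain ⟨u, rfl⟩ := h₁ (le_sup_left.trans hV)
    obtain ⟨v, rfl⟩ := h₂ (le_sup_right.trans hV)
    have hu := hV (Submodule.mem_sup_left (Submodule.mem_span_singleton_self u))
    obtain ⟨g, hg⟩ := hR.exists_mem_span_singleton hM hX hu v
    refine ⟨v + MonoidAlgebra.of F (Aut L M) g • u, le_antisymm (sup_le ?_ ?_) ?_⟩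
    · rwa [Submodule.span_singleton_le_iff_mem]
    · rw [Submodule.span_singleton_le_iff_mem]
      exact (Submodule.add_mem_iff_left _ (Submodule.smul_mem _ _ hg)).mp
        (Submodule.mem_span_singleton_self _)
    · rw [Submodule.span_singleton_le_iff_mem]
      exact Submodule.add_mem _
        (Submodule.mem_sup_right (Submodule.mem_span_singleton_self v))
        (Submodule.smul_mem _ _ (Submodule.mem_sup_left (Submodule.mem_span_singleton_self u)))
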